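/- Let $n\ge 0$ and let $A$ be an $n\times n$ matrix over $\mathbb{F}_3$. Let $f_1\mid f_2\mid\cdots\mid f_k$ be its invariant factors, that is, the uniquely determined monic non-constant polynomials over $\mathbb{F}_3$, each dividing the next, such that $A$ is similar to the direct sum of the companion matrices of $f_1,\dots,f_k$. Suppose that the first invariant factor $f_1$ is not an irreducible polynomial of degree $3$ with non-zero trace, where the trace of a monic polynomial $x^m-u_{m-1}x^{m-1}-\cdots-u_0$ is $u_{m-1}$, the trace of its companion matrix. (For $n=0$ there are no invariant factors and nothing is assumed.) Then there are $n\times n$ matrices $D$ and $M$ over $\mathbb{F}_3$ such that $A=D+M$, $D$ is diagonalizable over $\mathbb{F}_3$ (that is, similar over $\mathbb{F}_3$ to a diagonal matrix), and $M^2=0$. -/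

import Mathlib

open Polynomial

/-- The square matrices `X` and `Y` are similar: `U⁻¹ X U = Y` for some invertible `U`. -/
def MatSimilar {n K : Type*} [Fintype n] [DecidableEq n] [Field K] (X Y : Matrix n n K) : Prop :=
  ∃ U : (Matrix n n K)ˣ, (↑U⁻¹ : Matrix n n K) * X * (U : Matrix n n K) = Y

/-- A square matrix is diagonalizable (over its field of entries) if it is similar to a
diagonal matrix. -/
def MatDiagonalizable {n K : Type*} [Fintype n] [DecidableEq n] [Field K]
    (X : Matrix n n K) : Prop :=
  ∃ d : n → K, MatSimilar X (Matrix.diagonal d)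

/-- The companion matrix of a monic polynomial `p = x^m - u_{m-1} x^{m-1} - ⋯ - u_0`: ones on the
subdiagonal, last column `(u_0, …, u_{m-1})`, zeros elsewhere. -/
def companionMat {K : Type*} [Field K] (p : K[X]) :
    Matrix (Fin p.natDegree) (Fin p.natDegree) K :=
  Matrix.of fun i j =>
    if (j : ℕ) + 1 = p.natDegree then -p.coeff i else if (i : ℕ) = j + 1 then 1 else 0

/-- The trace of a monic polynomial `p = x^m - u_{m-1} x^{m-1} - ⋯ - u_0` is `u_{m-1}`, the sum of
its roots. -/
def polyTrace {K : Type*} [Field K] (p : K[X]) : K := -p.nextCoeff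

/-- The trace of a monic polynomial is the trace of its companion matrix. -/
theorem polyTrace_eq_trace_companionMat {K : Type*} [Field K] (p : K[X]) :
    polyTrace p = (companionMat p).trace := by
  by_cases hm : p.natDegree = 0
  · have : IsEmpty (Fin p.natDegree) := by rw [hm]; infer_instance
    simp [polyTrace, Polynomial.nextCoeff, hm, Matrix.trace]
  · rw [Matrix.trace, Finset.sum_eq_single (⟨p.natDegree - 1, by omega⟩ : Fin p.natDegree)]
    · have h1 : p.natDegree - 1 + 1 = p.natDegree := by omega
      simp [polyTrace, Polynomial.nextCoeff, hm, companionMat, h1]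
    · intro j _ hj
      have h2 : (j : ℕ) + 1 ≠ p.natDegree := fun h => hj (Fin.ext (by simp; omega))
      simp [companionMat, h2]
    · simp

/-- `f 0, …, f (k-1)` are the (non-constant) invariant factors of the matrix `A`, listed so that
each divides the next: they are monic and non-constant, `f 0 ∣ f 1 ∣ ⋯ ∣ f (k-1)`, and `A` is
similar to the direct sum of their companion matrices (its rational canonical form). The bijection
`e` numbers the rows of that direct sum; its choice only changes the matrix by a permutation
similarity. -/
def IsInvariantFactors {n K : Type*} [Fintype n] [DecidableEq n] [Field K]
    (A : Matrix n n K) {k : ℕ} (f : Fin k → K[X]) : Prop :=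
  (∀ i, (f i).Monic) ∧ (∀ i, 0 < (f i).natDegree) ∧ (∀ i j, i ≤ j → f i ∣ f j) ∧
    ∃ e : (Σ i : Fin k, Fin (f i).natDegree) ≃ n,
      MatSimilar A (Matrix.reindex e e (Matrix.blockDiagonal' fun i => companionMat (f i)))

/-- `p` is the first (smallest) invariant factor of `A`: the one that divides all the others. -/
def IsFirstInvariantFactor {n K : Type*} [Fintype n] [DecidableEq n] [Field K]
    (A : Matrix n n K) (p : K[X]) : Prop :=
  ∃ (k : ℕ) (f : Fin (k + 1) → K[X]), IsInvariantFactors A f ∧ f 0 = p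

/-!
Over `ZMod 3` a matrix `D` is diagonalizable as soon as `D ^ 3 = D`, so the aim is to write `A` as
the sum of a tripotent matrix and a matrix of square zero (`IsTripotentAddSqZero`). This property
passes to direct sums and similar matrices, and `A` has a rational canonical form
(`exists_isInvariantFactors`). Call a polynomial exceptional if it is irreducible of degree `3` with
non-zero trace. If some invariant factor were exceptional, then the first one, a non-constant monic
divisor of it, would be equal to it. So under the hypothesis no invariant factor is exceptional, and
it suffices to treat the companion matrix of a single non-exceptional `f`.

In a basis of Newton polynomials, multiplication by `X` modulo `f` becomes an upper Hessenberg
matrix whose diagonal can be prescribed, subject to having sum the trace of `f`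
(`exists_matSimilar_hessenbergMat`). Prescribe zeros in every second place. Sorting the basis into
the vectors `U` with prescribed zero and the other ones `W` gives a block matrix
`[[0, Z], [J, Y]]`, where `J` identifies `U` with `W`, or with all of `W` but its first vector, and
`Y` is diagonal apart from its last column. A change of `Z` is a change by a matrix of square zero.
If `Y ^ 3 = Y`, then replacing `Z` by `J⁻¹ * (1 - Y ^ 2)`, for a suitable partial inverse of `J`,
makes the block matrix tripotent (`IsTripotentAddSqZero.fromBlocks`). Now `Y ^ 3 = Y` holds when the
last diagonal entry of `Y` differs from all others, and in odd degree the partial inverse works when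
the first entry is minus the last. From degree `2` on these conditions can be met for every trace,
except in degree `3` with non-zero trace; there a non-exceptional `f` has a root, and the
decomposition is written down.
-/

/-! ### Similarity and diagonalizability -/

theorem matSimilar_of_mul_eq {n K : Type*} [Fintype n] [DecidableEq n] [Field K]
    {A B U : Matrix n n K} (hU : IsUnit U) (h : A * U = U * B) : MatSimilar A B := by
  obtain ⟨u, rfl⟩ := hU
  refine ⟨u, ?_⟩
  rw [mul_assoc, h, ← mul_assoc, Units.inv_mul, one_mul]

theorem matSimilar_of_mulVec_eq {n K : Type*} [Fintype n] [DecidableEq n] [Field K]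
    {A B : Matrix n n K} {v : n → n → K} (hv : LinearIndependent K v)
    (h : ∀ j, A.mulVec (v j) = ∑ i, B i j • v i) : MatSimilar A B := by
  refine matSimilar_of_mul_eq (U := (Matrix.of v).transpose)
    (Matrix.linearIndependent_cols_iff_isUnit.mp hv) ?_
  ext i j
  have := congrFun (h j) i
  simpa [Matrix.mul_apply, Matrix.mulVec, dotProduct, mul_comm] using this

theorem matDiagonalizable_of_pow_three_eq {n : Type*} [Fintype n] [DecidableEq n]
    {D : Matrix n n (ZMod 3)} (hD : D ^ 3 = D) : MatDiagonalizable D := by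
  classical
  set T : Module.End (ZMod 3) (n → ZMod 3) := Matrix.toLin' D with hT
  have hT3 : ∀ x, T (T (T x)) = T x := by
    intro x
    have h := congrArg (fun M : Matrix n n (ZMod 3) => M.mulVec x) hD
    simpa [hT, pow_succ, Matrix.mulVec_mulVec, mul_assoc] using h
  have h2 : ∀ x : n → ZMod 3, x + x = -x := by
    intro x
    ext i
    have : ∀ a : ZMod 3, a + a = -a := by decide
    exact this _
  have hmem : ∀ (a : ZMod 3) x, T x = a • x → x ∈ ⨆ μ, T.eigenspace μ := fun a x hx =>
    Submodule.mem_iSup_of_mem a (Module.End.mem_eigenspace_iff.mpr hx)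
  have htop : ⨆ μ, T.eigenspace μ = ⊤ := by
    refine eq_top_iff.mpr fun x _ => ?_
    -- The three Lagrange idempotents of `t ^ 3 - t` split `x` into eigenvectors.
    have hx : x = (x - T (T x)) + (-(T (T x) + T x)) + (T x - T (T x)) := by
      have := h2 (T (T x))
      rw [eq_neg_iff_add_eq_zero] at this
      linear_combination this
    rw [hx]
    refine add_mem (add_mem (hmem 0 _ ?_) (hmem 1 _ ?_)) (hmem (-1) _ ?_)
    · simp [hT3]
    · simp [hT3, add_comm]
    · simp [hT3]
  have hint : DirectSum.IsInternal fun μ => T.eigenspace μ :=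
    (DirectSum.isInternal_submodule_iff_iSupIndep_and_iSup_eq_top _).mpr
      ⟨T.eigenspaces_iSupIndep, htop⟩
  let b := hint.collectedBasis fun μ => Module.finBasis (ZMod 3) (T.eigenspace μ)
  let e := b.indexEquiv (Pi.basisFun (ZMod 3) n)
  let b' := b.reindex e
  refine ⟨fun j => (e.symm j).1, matSimilar_of_mulVec_eq b'.linearIndependent fun j => ?_⟩
  have hj : T (b' j) = (e.symm j).1 • b' j := by
    rw [Module.Basis.reindex_apply]
    exact Module.End.mem_eigenspace_iff.mp (hint.collectedBasis_mem _ _)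
  rw [← Matrix.toLin'_apply, ← hT, hj, Finset.sum_eq_single j]
  · simp
  · intro i _ hij
    simp [Matrix.diagonal_apply_ne _ hij]
  · simp

/-- A matrix is the sum of a matrix `D` with `D ^ 3 = D` and a matrix of square zero. Over `ZMod 3`
the condition on `D` says that `D` is diagonalizable, all elements of the field being roots of
`t ^ 3 - t`. -/
def IsTripotentAddSqZero {n K : Type*} [Fintype n] [DecidableEq n] [Field K]
    (A : Matrix n n K) : Prop :=
  ∃ D M : Matrix n n K, D ^ 3 = D ∧ M ^ 2 = 0 ∧ A = D + M

namespace IsTripotentAddSqZero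

variable {m n K : Type*} [Fintype m] [DecidableEq m] [Fintype n] [DecidableEq n] [Field K]

theorem of_similar {A B : Matrix n n K} (h : MatSimilar A B) (hB : IsTripotentAddSqZero B) :
    IsTripotentAddSqZero A := by
  obtain ⟨u, rfl⟩ := h
  obtain ⟨D, M, hD, hM, h⟩ := hB
  refine ⟨(u : Matrix n n K) * D * (↑u⁻¹ : Matrix n n K),
    (u : Matrix n n K) * M * (↑u⁻¹ : Matrix n n K), ?_, ?_, ?_⟩
  · rw [Units.conj_pow, hD]
  · rw [Units.conj_pow, hM, mul_zero, zero_mul]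
  · rw [← add_mul, ← mul_add, ← h]
    simp [mul_assoc]

theorem of_reindex {A : Matrix m m K} (e : m ≃ n)
    (h : IsTripotentAddSqZero (Matrix.reindex e e A)) : IsTripotentAddSqZero A := by
  obtain ⟨D, M, hD, hM, h⟩ := h
  let φ := Matrix.reindexAlgEquiv K K e.symm
  refine ⟨φ D, φ M, ?_, ?_, ?_⟩
  · rw [← map_pow, hD]
  · rw [← map_pow, hM, map_zero]
  · rw [← map_add, ← h]
    ext i j
    simp [φ]

theorem reindex {A : Matrix m m K} (e : m ≃ n) (h : IsTripotentAddSqZero A) :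
    IsTripotentAddSqZero (Matrix.reindex e e A) := by
  refine of_reindex e.symm ?_
  convert h
  ext i j
  simp

theorem blockDiagonal' {o : Type*} [Fintype o] [DecidableEq o] {m : o → Type*}
    [∀ i, Fintype (m i)] [∀ i, DecidableEq (m i)] {A : ∀ i, Matrix (m i) (m i) K}
    (h : ∀ i, IsTripotentAddSqZero (A i)) : IsTripotentAddSqZero (Matrix.blockDiagonal' A) := by
  choose D M hD hM hA using h
  refine ⟨Matrix.blockDiagonal' D, Matrix.blockDiagonal' M, ?_, ?_, ?_⟩
  · rw [← Matrix.blockDiagonal'_pow]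
    exact congrArg _ (funext hD)
  · rw [← Matrix.blockDiagonal'_pow, ← Matrix.blockDiagonal'_zero]
    exact congrArg _ (funext hM)
  · rw [← Matrix.blockDiagonal'_add]
    exact congrArg _ (funext hA)

end IsTripotentAddSqZero

/-! ### Existence of the invariant factors -/

/-- Some vector has the whole minimal polynomial as its order. -/
theorem Module.End.exists_minpoly_dvd_of_aeval_apply_eq_zero {K V : Type*} [Field K]
    [AddCommGroup V] [Module K V] [FiniteDimensional K V] (T : Module.End K V) :
    ∃ v : V, ∀ q : K[X], aeval T q v = 0 → minpoly K T ∣ q := by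
  obtain ⟨x, hx⟩ := Module.exists_ker_toSpanSingleton_eq_annihilator K[X] (Module.AEval' T)
  obtain ⟨v, rfl⟩ := (Module.AEval'.of T).surjective x
  refine ⟨v, fun q hq => ?_⟩
  rw [← span_minpoly_eq_annihilator] at hx
  rw [← Ideal.mem_span_singleton]
  have : q ∈ LinearMap.ker (LinearMap.toSpanSingleton K[X] _ (Module.AEval'.of T v)) := by
    rw [LinearMap.mem_ker, LinearMap.toSpanSingleton_apply]
    have := Module.AEval.of_aeval_smul (R := K) (M := V) (a := T) q v
    rw [← this, Module.End.smul_def, hq, map_zero]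
  rwa [hx] at this

theorem Module.End.coe_aeval_restrict_apply {K V : Type*} [Field K] [AddCommGroup V] [Module K V]
    {T : Module.End K V} {W : Submodule K V} (h : ∀ x ∈ W, T x ∈ W) (q : K[X]) (w : W) :
    ((aeval (T.restrict h) q w : W) : V) = aeval T q (w : V) := by
  induction q using Polynomial.induction_on generalizing w with
  | C a => simp [Module.algebraMap_end_apply]
  | add p q hp hq => simp [hp, hq]
  | monomial n a ih =>
    rw [pow_succ, ← mul_assoc, map_mul, Module.End.mul_apply, ih, map_mul (aeval T),
      Module.End.mul_apply]
    simp

/-- A cyclic submodule generated by a vector `v` whose order is the whole minimal polynomial of `T`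
has a `T`-stable complement, on which the last assertion expresses that the sum is direct. -/
theorem Module.End.exists_invariant_complement {K V : Type*} [Field K]
    [AddCommGroup V] [Module K V] [FiniteDimensional K V] (T : Module.End K V) {v : V}
    (hv : ∀ q : K[X], aeval T q v = 0 → minpoly K T ∣ q) :
    ∃ W : Submodule K V, (∀ x ∈ W, T x ∈ W) ∧ (∀ x, ∃ q : K[X], x - aeval T q v ∈ W) ∧
      ∀ q : K[X], aeval T q v ∈ W → aeval T q v = 0 := by
  set μ := minpoly K T with hμ
  have hμm : μ.Monic := minpoly.monic (Algebra.IsIntegral.isIntegral T)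
  have hmod : ∀ q : K[X], aeval T (q %ₘ μ) = aeval T q := fun q => by
    conv_rhs => rw [← modByMonic_add_div q μ]
    simp [hμ]
  set d := μ.natDegree with hd
  have hlt : ∀ q : K[X], q %ₘ μ ∈ degreeLT K d := fun q => by
    rw [mem_degreeLT, hd, ← degree_eq_natDegree hμm.ne_zero]
    exact degree_modByMonic_lt q hμm
  let L : degreeLT K d →ₗ[K] V :=
    (LinearMap.applyₗ v) ∘ₗ (aeval T).toLinearMap ∘ₗ (degreeLT K d).subtype
  have hL : LinearMap.ker L = ⊥ := by
    refine LinearMap.ker_eq_bot'.mpr fun r hr => ?_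
    have h1 : μ ∣ (r : K[X]) := hv _ (by simpa [L] using hr)
    have h2 : (r : K[X]).degree < μ.degree :=
      (mem_degreeLT.mp r.2).trans_eq (degree_eq_natDegree hμm.ne_zero).symm
    exact Subtype.ext (eq_zero_of_dvd_of_degree_lt h1 h2)
  obtain ⟨g, hg⟩ := LinearMap.exists_leftInverse_of_injective L hL
  let φ : V →ₗ[K] K := lcoeff K (d - 1) ∘ₗ (degreeLT K d).subtype ∘ₗ g
  have hφ : ∀ r ∈ degreeLT K d, φ (aeval T r v) = r.coeff (d - 1) := fun r hr => by
    have := LinearMap.congr_fun hg ⟨r, hr⟩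
    change g (aeval T r v) = _ at this
    simp [φ, this]
  have hnondeg : ∀ r ∈ degreeLT K d, (∀ i < d, φ (aeval T (X ^ i * r) v) = 0) → r = 0 := by
    intro r hr h
    by_contra hr0
    have hrd : r.natDegree < d := by
      rw [mem_degreeLT, degree_eq_natDegree hr0] at hr
      exact_mod_cast hr
    have h1 := h (d - 1 - r.natDegree) (by omega)
    rw [hφ, show d - 1 = r.natDegree + (d - 1 - r.natDegree) by omega] at h1
    · rw [Nat.add_sub_cancel_left, coeff_X_pow_mul] at h1
      exact hr0 (leadingCoeff_eq_zero.mp h1)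
    · rw [mem_degreeLT, degree_eq_natDegree (mul_ne_zero (pow_ne_zero _ X_ne_zero) hr0),
        natDegree_X_pow_mul _ hr0]
      exact_mod_cast (by omega)
  let W : Submodule K V := ⨅ q : K[X], LinearMap.ker (φ ∘ₗ aeval T q)
  have hW : ∀ x, x ∈ W ↔ ∀ q : K[X], φ (aeval T q x) = 0 := fun x => by
    simp [W, Submodule.mem_iInf]
  have hW' : ∀ x, (∀ i < d, φ (aeval T (X ^ i : K[X]) x) = 0) → x ∈ W := fun x hx => by
    refine (hW x).mpr fun q => ?_
    by_cases h0 : q %ₘ μ = 0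
    · rw [← hmod, h0]
      simp
    have hqd : (q %ₘ μ).natDegree < d := by
      have := hlt q
      rw [mem_degreeLT, degree_eq_natDegree h0] at this
      exact_mod_cast this
    rw [← hmod, (q %ₘ μ).as_sum_range' d hqd, map_sum, LinearMap.sum_apply, map_sum]
    refine Finset.sum_eq_zero fun i hi => ?_
    rw [← C_mul_X_pow_eq_monomial, ← smul_eq_C_mul, map_smul, LinearMap.smul_apply, map_smul,
      hx i (Finset.mem_range.mp hi), smul_zero]
  refine ⟨W, fun x hx => (hW _).mpr fun q => ?_, fun x => ?_, fun q hq => ?_⟩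
  · have := (hW x).mp hx (q * X)
    simpa using this
  · let S : degreeLT K d →ₗ[K] (Fin d → K) :=
      LinearMap.pi fun i => φ ∘ₗ aeval T (X ^ (i : ℕ) : K[X]) ∘ₗ L
    have hSinj : Function.Injective S := by
      refine (injective_iff_map_eq_zero S).mpr fun r hr => Subtype.ext (hnondeg r r.2 ?_)
      intro i hi
      have := congrFun hr ⟨i, hi⟩
      simpa [S, L] using this
    have hfr : Module.finrank K (degreeLT K d) = Module.finrank K (Fin d → K) :=
      (degreeLTEquiv K d).finrank_eq
    have : FiniteDimensional K (degreeLT K d) := (degreeLTEquiv K d).symm.finiteDimensional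
    have hSsurj := (LinearMap.injective_iff_surjective_of_finrank_eq_finrank hfr).mp hSinj
    obtain ⟨r, hr⟩ := hSsurj fun i => φ (aeval T (X ^ (i : ℕ) : K[X]) x)
    refine ⟨r, hW' _ fun i hi => ?_⟩
    have := congrFun hr ⟨i, hi⟩
    rw [map_sub, map_sub, sub_eq_zero]
    exact this.symm
  · rw [← hmod] at hq ⊢
    rw [hnondeg _ (hlt q) fun i _ => by simpa using (hW _).mp hq (X ^ i)]
    simp

universe u

/-- The invariant factor decomposition. That `V` is the direct sum of the cyclic submodules
generated by the `v i`, with orders `f i`, is expressed by polynomial coefficients: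
every vector is some `∑ i, q i (T) (v i)`, and such a sum vanishes only if `f i ∣ q i` for all `i`. -/
theorem Module.End.exists_cyclic_decomposition {K : Type*} [Field K] (N : ℕ) :
    ∀ (V : Type u) [AddCommGroup V] [Module K V] [FiniteDimensional K V] (T : Module.End K V),
      Module.finrank K V = N → ∃ (k : ℕ) (f : Fin k → K[X]) (v : Fin k → V),
        (∀ i, (f i).Monic) ∧ (∀ i, 0 < (f i).natDegree) ∧ (∀ i j, i ≤ j → f i ∣ f j) ∧
        (∀ i, aeval T (f i) (v i) = 0) ∧
        (∀ x, ∃ q : Fin k → K[X], x = ∑ i, aeval T (q i) (v i)) ∧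
        ∀ q : Fin k → K[X], ∑ i, aeval T (q i) (v i) = 0 → ∀ i, f i ∣ q i := by
  induction N using Nat.strong_induction_on with
  | _ N ih =>
  intro V _ _ _ T hN
  rcases subsingleton_or_nontrivial V with hV | hV
  · exact ⟨0, Fin.elim0, Fin.elim0, fun i => i.elim0, fun i => i.elim0, fun i => i.elim0,
      fun i => i.elim0, fun x => ⟨Fin.elim0, Subsingleton.elim _ _⟩, fun _ _ i => i.elim0⟩
  obtain ⟨v, hv⟩ := T.exists_minpoly_dvd_of_aeval_apply_eq_zero
  obtain ⟨W, hTW, hsup, hdisj⟩ := T.exists_invariant_complement hv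
  have hint : IsIntegral K T := Algebra.IsIntegral.isIntegral T
  have hv0 : v ≠ 0 := by
    rintro rfl
    exact minpoly.not_isUnit K T (isUnit_of_dvd_one (hv 1 (map_zero _)))
  have hvW : v ∉ W := fun h => hv0 (by simpa using hdisj 1 (by simpa using h))
  have hWlt : Module.finrank K W < N := hN ▸ Submodule.finrank_lt (fun h => hvW (h ▸ trivial))
  obtain ⟨k, f, w, hfm, hfd, hfdvd, hfw, hspan, hindep⟩ := ih _ hWlt W (T.restrict hTW) rfl
  have hfμ : ∀ i, f i ∣ minpoly K T := fun i => by
    have := hindep (Pi.single i (minpoly K T)) (by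
      refine Finset.sum_eq_zero fun j _ => Subtype.ext ?_
      rw [coe_aeval_restrict_apply]
      by_cases hij : j = i
      · subst hij; simp
      · simp [hij]) i
    simpa using this
  refine ⟨k + 1, Fin.snoc f (minpoly K T), Fin.snoc (fun i => (w i : V)) v, ?_, ?_, ?_, ?_, ?_, ?_⟩
  · refine Fin.lastCases ?_ fun i => ?_
    · simpa using minpoly.monic hint
    · simpa using hfm i
  · refine Fin.lastCases ?_ fun i => ?_
    · simpa using minpoly.natDegree_pos hint
    · simpa using hfd i
  · intro i j
    induction j using Fin.lastCases with
    | last =>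
      induction i using Fin.lastCases with
      | last => simp
      | cast i => simpa using fun _ => hfμ i
    | cast j =>
      induction i using Fin.lastCases with
      | last => exact fun h => absurd h (not_le.mpr (Fin.castSucc_lt_last j))
      | cast i => simpa using hfdvd i j
  · refine Fin.lastCases ?_ fun i => ?_
    · simp
    · rw [Fin.snoc_castSucc, Fin.snoc_castSucc, ← coe_aeval_restrict_apply hTW, hfw]
      rfl
  · intro x
    obtain ⟨p, hp⟩ := hsup x
    obtain ⟨q, hq⟩ := hspan ⟨_, hp⟩
    refine ⟨Fin.snoc q p, ?_⟩
    have := congrArg (Subtype.val) hq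
    simp only [Submodule.coe_sum, coe_aeval_restrict_apply] at this
    simp [Fin.sum_univ_castSucc, ← this]
  · intro q hq
    simp only [Fin.sum_univ_castSucc, Fin.snoc_castSucc, Fin.snoc_last] at hq
    have hsum : ∑ i : Fin k, aeval T (q i.castSucc) (w i : V) =
        ((∑ i : Fin k, aeval (T.restrict hTW) (q i.castSucc) (w i) : W) : V) := by
      simp [coe_aeval_restrict_apply]
    rw [hsum] at hq
    have hlast : aeval T (q (Fin.last k)) v = 0 := by
      refine hdisj _ ?_
      rw [← neg_eq_of_add_eq_zero_right hq]
      exact W.neg_mem (Subtype.property _)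
    rw [hlast, add_zero] at hq
    refine Fin.lastCases ?_ fun i => ?_
    · simpa using hv _ hlast
    · simpa using hindep (fun i => q i.castSucc) (Subtype.ext hq) i

theorem aeval_X_pow_apply_eq_sum_companionMat {K V : Type*} [Field K] [AddCommGroup V]
    [Module K V] (T : Module.End K V) {f : K[X]} (hf : f.Monic) {v : V} (hv : aeval T f v = 0)
    (j : Fin f.natDegree) :
    T ((T ^ (j : ℕ)) v) = ∑ i, companionMat f i j • (T ^ (i : ℕ)) v := by
  rw [← Module.End.mul_apply, ← pow_succ']
  by_cases hj : (j : ℕ) + 1 = f.natDegree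
  · rw [hf.as_sum] at hv
    simp only [map_add, map_sum, map_mul, map_pow, aeval_X, aeval_C, LinearMap.add_apply,
      LinearMap.sum_apply, Module.End.mul_apply, Module.algebraMap_end_apply] at hv
    rw [hj, eq_neg_of_add_eq_zero_left hv,
      ← Fin.sum_univ_eq_sum_range (fun i => f.coeff i • (T ^ i) v), ← Finset.sum_neg_distrib]
    simp [companionMat, hj]
  · rw [Finset.sum_eq_single (⟨j + 1, by omega⟩ : Fin f.natDegree)]
    · simp [companionMat, hj]
    · intro i _ hi
      have : (i : ℕ) ≠ j + 1 := fun h => hi (Fin.ext h)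
      simp [companionMat, hj, this]
    · simp

theorem exists_isInvariantFactors {n K : Type*} [Fintype n] [DecidableEq n] [Field K]
    (A : Matrix n n K) : ∃ (k : ℕ) (f : Fin k → K[X]), IsInvariantFactors A f := by
  set T : Module.End K (n → K) := Matrix.toLin' A with hT
  obtain ⟨k, f, v, hfm, hfd, hfdvd, hfv, hspan, hindep⟩ :=
    Module.End.exists_cyclic_decomposition _ _ T rfl
  let w : (Σ i : Fin k, Fin (f i).natDegree) → n → K := fun p => (T ^ (p.2 : ℕ)) (v p.1)
  have hw : ∀ g : (Σ i : Fin k, Fin (f i).natDegree) → K, ∑ p, g p • w p =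
      ∑ i, aeval T (∑ j : Fin (f i).natDegree, C (g ⟨i, j⟩) * X ^ (j : ℕ)) (v i) := by
    intro g
    simp [Fintype.sum_sigma, w, LinearMap.sum_apply, Module.algebraMap_end_apply]
  have hcoeff : ∀ (m : ℕ) (c : Fin m → K) (j : Fin m),
      (∑ j : Fin m, C (c j) * X ^ (j : ℕ)).coeff j = c j := by
    intro m c j
    simp [coeff_X_pow, Fin.val_inj]
  have hli : LinearIndependent K w := by
    refine Fintype.linearIndependent_iff.mpr fun g hg => ?_
    rintro ⟨i, j⟩
    rw [hw] at hg
    have h1 := hindep _ hg i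
    have h2 : ∑ j : Fin (f i).natDegree, C (g ⟨i, j⟩) * X ^ (j : ℕ) = 0 := by
      refine eq_zero_of_dvd_of_degree_lt h1 ?_
      rw [degree_eq_natDegree (hfm i).ne_zero]
      exact degree_sum_fin_lt _
    rw [← hcoeff _ (fun j => g ⟨i, j⟩) j, h2, coeff_zero]
  have hsp : ⊤ ≤ Submodule.span K (Set.range w) := by
    intro x _
    obtain ⟨q, rfl⟩ := hspan x
    refine sum_mem fun i _ => ?_
    have hmod : aeval T (q i) (v i) = aeval T (q i %ₘ f i) (v i) := by
      conv_lhs => rw [← modByMonic_add_div (q i) (f i)]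
      rw [mul_comm, map_add, map_mul]
      simp [hfv]
    have hlt : (q i %ₘ f i).natDegree < (f i).natDegree :=
      natDegree_modByMonic_lt _ (hfm i) fun h => by simpa [h] using hfd i
    rw [hmod, (q i %ₘ f i).as_sum_range' _ hlt, map_sum, LinearMap.sum_apply]
    refine sum_mem fun j hj => ?_
    rw [← C_mul_X_pow_eq_monomial, ← smul_eq_C_mul, map_smul, map_pow, aeval_X]
    exact Submodule.smul_mem _ _ (Submodule.subset_span ⟨⟨i, j, Finset.mem_range.mp hj⟩, rfl⟩)
  let e := (Module.Basis.mk hli hsp).indexEquiv (Pi.basisFun K n)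
  refine ⟨k, f, hfm, hfd, hfdvd, e,
    matSimilar_of_mulVec_eq (hli.comp e.symm e.symm.injective) fun x => ?_⟩
  obtain ⟨⟨i, j⟩, rfl⟩ := e.surjective x
  rw [← e.sum_comp, Fintype.sum_sigma, Finset.sum_eq_single i]
  · simp only [Function.comp_apply, Equiv.symm_apply_apply, Matrix.reindex_apply,
      Matrix.submatrix_apply, Matrix.blockDiagonal'_apply_eq]
    exact aeval_X_pow_apply_eq_sum_companionMat T (hfm i) (hfv i) j
  · intro i' _ hi'
    refine Finset.sum_eq_zero fun j' _ => ?_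
    simp [Matrix.blockDiagonal'_apply_ne _ _ _ hi']
  · simp

/-! ### Hessenberg form of a companion matrix -/

/-- The upper Hessenberg matrix with diagonal `d 0, d 1, …`, ones on the subdiagonal, entries `a i`
in the last column above the diagonal, and zeros elsewhere. -/
def hessenbergMat {K : Type*} [Field K] (n : ℕ) (d a : ℕ → K) : Matrix (Fin n) (Fin n) K :=
  Matrix.of fun i j =>
    if (i : ℕ) = j then d j else if (j : ℕ) + 1 = n then a i else if (i : ℕ) = j + 1 then 1 else 0

/-- The Newton polynomial `(X - d 0) ⋯ (X - d (j - 1))`. -/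
noncomputable def newtonPoly {K : Type*} [Field K] (d : ℕ → K) (j : ℕ) : K[X] :=
  ∏ i ∈ Finset.range j, (X - C (d i))

section

variable {K : Type*} [Field K]

theorem newtonPoly_monic (d : ℕ → K) (j : ℕ) : (newtonPoly d j).Monic :=
  monic_prod_of_monic _ _ fun i _ => monic_X_sub_C (d i)

theorem natDegree_newtonPoly (d : ℕ → K) (j : ℕ) : (newtonPoly d j).natDegree = j := by
  rw [newtonPoly, natDegree_prod_of_monic _ _ fun i _ => monic_X_sub_C (d i)]
  simp

theorem X_mul_newtonPoly (d : ℕ → K) (j : ℕ) :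
    X * newtonPoly d j = C (d j) * newtonPoly d j + newtonPoly d (j + 1) := by
  simp only [newtonPoly, Finset.prod_range_succ]
  ring

theorem exists_eq_sum_newtonPoly (d : ℕ → K) (k : ℕ) :
    ∀ q : K[X], q.degree < k →
      ∃ a : ℕ → K, q = ∑ j ∈ Finset.range k, C (a j) * newtonPoly d j := by
  induction k with
  | zero => exact fun q hq => ⟨0, by simpa [Nat.WithBot.lt_zero_iff] using hq⟩
  | succ k ih =>
    intro q hq
    have hP : (newtonPoly d k).coeff k = 1 := by
      have := newtonPoly_monic d k
      rwa [Monic, leadingCoeff, natDegree_newtonPoly] at this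
    obtain ⟨a, ha⟩ := ih (q - C (q.coeff k) * newtonPoly d k) (by
      rw [degree_lt_iff_coeff_zero] at hq ⊢
      intro i hi
      rcases hi.eq_or_lt with rfl | hi
      · simp [hP]
      · rw [coeff_sub, coeff_C_mul, hq i hi, coeff_eq_zero_of_natDegree_lt (p := newtonPoly d k)]
        · simp
        · rwa [natDegree_newtonPoly])
    refine ⟨Function.update a k (q.coeff k), ?_⟩
    rw [Finset.sum_range_succ, Function.update_self, ← sub_eq_iff_eq_add, ha]
    refine Finset.sum_congr rfl fun j hj => ?_
    rw [Function.update_of_ne (Finset.mem_range.mp hj).ne]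

/-- In coordinates `1, X, X ^ 2, …` the companion matrix of `f` is multiplication by `X`
modulo `f`. -/
theorem companionMat_mulVec_coeff {f : K[X]} {m : ℕ} (hm : f.natDegree = m + 1) (q : K[X])
    (i : Fin f.natDegree) :
    ∑ k, companionMat f i k * q.coeff k = (X * q - C (q.coeff m) * f).coeff i := by
  have hi : (i : ℕ) < m + 1 := hm ▸ i.2
  obtain ⟨i, hi'⟩ := i
  have h := Fin.sum_univ_eq_sum_range (fun k => (if k + 1 = f.natDegree then -f.coeff i else
    if i = k + 1 then 1 else 0) * q.coeff k) f.natDegree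
  simp only [companionMat, Matrix.of_apply]
  rw [h, hm, Finset.sum_range_succ, Finset.sum_congr rfl (g := fun k =>
    if i = k + 1 then q.coeff k else 0)]
  · rw [coeff_sub, coeff_C_mul]
    rcases i with _ | i
    · simp [mul_comm]
    · simp [mul_comm, sub_eq_add_neg, show i < m by simpa using hi]
  · intro k hk
    have : k ≠ m := (Finset.mem_range.mp hk).ne
    simp [this]

/-- In the basis of Newton polynomials, multiplication by `X` modulo `f` has an upper Hessenberg
matrix, whose diagonal is arbitrary apart from its sum. -/
theorem exists_matSimilar_hessenbergMat {f : K[X]} (hf : f.Monic) {m : ℕ}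
    (hm : f.natDegree = m + 1) (d : ℕ → K)
    (hd : ∑ i ∈ Finset.range (m + 1), d i = polyTrace f) :
    ∃ a : ℕ → K, MatSimilar (companionMat f) (hessenbergMat f.natDegree d a) ∧
      newtonPoly d (m + 1) - f = ∑ j ∈ Finset.range m, C (a j) * newtonPoly d j := by
  have hlead : ∀ j, (newtonPoly d j).coeff j = 1 := fun j => by
    have := newtonPoly_monic d j
    rwa [Monic, leadingCoeff, natDegree_newtonPoly] at this
  have hdeg : (newtonPoly d (m + 1) - f).degree < m := by
    rw [degree_lt_iff_coeff_zero]
    intro i hi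
    rw [coeff_sub, sub_eq_zero]
    rcases hi.eq_or_lt with rfl | hi
    · have h1 := prod_X_sub_C_nextCoeff (s := Finset.range (m + 1)) d
      have h2 : (newtonPoly d (m + 1)).nextCoeff = (newtonPoly d (m + 1)).coeff m := by
        simp [nextCoeff, natDegree_newtonPoly]
      have h3 : f.nextCoeff = f.coeff m := by simp [nextCoeff, hm]
      rw [← h2, newtonPoly, h1, hd, polyTrace, neg_neg, h3]
    · rcases (Nat.succ_le_of_lt hi).eq_or_lt with rfl | hi
      · have := hf.coeff_natDegree
        rw [hm] at this
        rw [Nat.succ_eq_add_one, hlead, this]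
      · rw [coeff_eq_zero_of_natDegree_lt, coeff_eq_zero_of_natDegree_lt]
        · omega
        · rw [natDegree_newtonPoly]; omega
  obtain ⟨a, ha⟩ := exists_eq_sum_newtonPoly d m _ hdeg
  refine ⟨a, ?_, ha⟩
  refine matSimilar_of_mul_eq (U := Matrix.of fun i j => (newtonPoly d j).coeff i) ?_ ?_
  · rw [Matrix.isUnit_iff_isUnit_det, Matrix.det_of_isUpperTriangular]
    · simp [hlead]
    · intro i j hij
      exact coeff_eq_zero_of_natDegree_lt ((natDegree_newtonPoly d j).trans_lt hij)
  · ext i j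
    rw [Matrix.mul_apply, Matrix.mul_apply]
    simp only [Matrix.of_apply, hessenbergMat]
    rw [companionMat_mulVec_coeff hm, X_mul_newtonPoly]
    obtain ⟨i, hi⟩ := i
    obtain ⟨j, hj⟩ := j
    have h := Fin.sum_univ_eq_sum_range (fun k => (newtonPoly d k).coeff i *
      (if k = j then d j else if j + 1 = f.natDegree then a k else
        if k = j + 1 then 1 else 0)) f.natDegree
    dsimp only
    rw [h, hm]
    by_cases hjm : j = m
    · rw [hjm, hlead, C_1, one_mul, add_sub_assoc, ha, coeff_add, finsetSum_coeff,
        Finset.sum_range_succ, add_comm]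
      congr 1
      · refine Finset.sum_congr rfl fun k hk => ?_
        have : k ≠ m := (Finset.mem_range.mp hk).ne
        simp [this, mul_comm]
      · simp [mul_comm]
    · rw [coeff_eq_zero_of_natDegree_lt (p := newtonPoly d j) (n := m), C_0, zero_mul, sub_zero,
        coeff_add, coeff_C_mul,
        Finset.sum_eq_add j (j + 1) (by omega)]
      · simp [hjm, mul_comm]
      · rintro k - ⟨h1, h2⟩
        simp [h1, h2, hjm]
      · intro h; exact absurd (Finset.mem_range.mpr (by omega)) h
      · intro h; exact absurd (Finset.mem_range.mpr (by omega)) h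
      · rw [natDegree_newtonPoly]; omega

end

/-! ### Block matrices with a tripotent corner -/

/-- The diagonal matrix with diagonal `y`, with the vector `c` added to its column `l`. -/
def diagAddCol {ι K : Type*} [DecidableEq ι] [Field K] (l : ι) (y c : ι → K) : Matrix ι ι K :=
  Matrix.of fun i j => (if i = j then y i else 0) + if j = l then c i else 0

theorem diagAddCol_mul {ι K : Type*} [Fintype ι] [DecidableEq ι] [Field K] (l : ι)
    (y c z b : ι → K) : diagAddCol l y c * diagAddCol l z b =
      diagAddCol l (fun i => y i * z i) (fun i => y i * b i + c i * z l + c i * b l) := by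
  ext i j
  simp only [diagAddCol, Matrix.mul_apply, Matrix.of_apply, add_mul, ite_mul, zero_mul,
    Finset.sum_add_distrib, Finset.sum_ite_eq, Finset.sum_ite_eq', Finset.mem_univ, if_true]
  by_cases hij : i = j <;> by_cases hj : j = l
  · subst hij; subst hj; simp; ring
  · subst hij; simp [hj, Ne.symm hj]
  · subst hj; simp [hij]; ring
  · simp [hij, hj, Ne.symm hj]

theorem diagAddCol_pow_three {ι : Type*} [Fintype ι] [DecidableEq ι] {l : ι} {y c : ι → ZMod 3}
    (hc : c l = 0) (hy : ∀ i, i ≠ l → y i ≠ y l) : diagAddCol l y c ^ 3 = diagAddCol l y c := by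
  have h1 : ∀ a : ZMod 3, a * (a * a) = a := by decide
  -- Distinct `a` and `b` are roots of `t ^ 3 - t`, so they are roots of its divided difference.
  have h2 : ∀ a b c : ZMod 3, a ≠ b → a * (a * c + c * b) + c * (b * b) = c := by decide
  rw [pow_succ', pow_two, diagAddCol_mul, diagAddCol_mul]
  congr 1
  · exact funext fun i => h1 _
  · funext i
    by_cases hi : i = l
    · subst hi; simp [hc]
    · simpa [hc] using h2 _ _ (c i) (hy i hi)

namespace IsTripotentAddSqZero

/-- For blocks with `Y ^ 3 = Y`, replacing the upper right block by `P * (1 - Y ^ 2)` makes the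
matrix tripotent; the difference has square zero, being an upper right block. -/
theorem fromBlocks {U W K : Type*} [Fintype U] [DecidableEq U] [Fintype W] [DecidableEq W]
    [Field K] (Z P : Matrix U W K) (J : Matrix W U K) {Y : Matrix W W K} (hY : Y ^ 3 = Y)
    (hJP : J * P * (1 - Y ^ 2) = 1 - Y ^ 2) :
    IsTripotentAddSqZero (Matrix.fromBlocks 0 Z J Y) := by
  have hQY : (1 - Y ^ 2) * Y = 0 := by
    rw [sub_mul, one_mul, ← pow_succ, hY, sub_self]
  refine ⟨Matrix.fromBlocks 0 (P * (1 - Y ^ 2)) J Y,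
    Matrix.fromBlocks 0 (Z - P * (1 - Y ^ 2)) 0 0, ?_, ?_, ?_⟩
  · rw [pow_succ', pow_two (Matrix.fromBlocks _ _ _ _), Matrix.fromBlocks_multiply,
      Matrix.fromBlocks_multiply]
    have h1 : J * (P * (1 - Y ^ 2)) + Y * Y = 1 := by
      rw [← Matrix.mul_assoc, hJP, ← pow_two, sub_add_cancel]
    have h2 : P * (1 - Y ^ 2) * Y = 0 := by
      rw [Matrix.mul_assoc, hQY, Matrix.mul_zero]
    have h3 : J * (P * (1 - Y ^ 2) * J) + Y * (Y * J) = J := by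
      rw [← Matrix.mul_assoc, ← Matrix.mul_assoc Y, ← Matrix.add_mul, h1, Matrix.one_mul]
    simp only [h1, h2, Matrix.zero_mul, Matrix.mul_zero, zero_add, add_zero, Matrix.mul_one, h3]
    rw [← Matrix.mul_assoc, h2, Matrix.zero_mul]
  · rw [pow_two, Matrix.fromBlocks_multiply]
    simp
  · rw [Matrix.fromBlocks_add]
    simp

theorem of_subsingleton {n : Type*} [Fintype n] [DecidableEq n] [Subsingleton n]
    (A : Matrix n n (ZMod 3)) : IsTripotentAddSqZero A := by
  have h : ∀ a : ZMod 3, a ^ 3 = a := by decide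
  refine ⟨A, 0, ?_, by simp, by simp⟩
  have hA : A = Matrix.diagonal fun i => A i i := by
    ext i j
    rw [Subsingleton.elim j i, Matrix.diagonal_apply_eq]
  rw [hA, Matrix.diagonal_pow]
  exact congrArg _ (funext fun i => h _)

end IsTripotentAddSqZero

/-! ### Companion matrices over `ZMod 3` -/

theorem sum_range_two_mul_of_odd {M : Type*} [AddCommMonoid M] (y : ℕ → M) (m : ℕ) :
    ∑ i ∈ Finset.range (2 * m), (if i % 2 = 1 then y (i / 2) else 0) =
      ∑ i ∈ Finset.range m, y i := by
  induction m with
  | zero => simp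
  | succ m ih =>
    rw [show 2 * (m + 1) = 2 * m + 1 + 1 by ring, Finset.sum_range_succ, Finset.sum_range_succ, ih,
      Finset.sum_range_succ]
    simp [show (2 * m + 1) % 2 = 1 by omega, show (2 * m + 1) / 2 = m by omega]

theorem sum_range_two_mul_add_one_of_even {M : Type*} [AddCommMonoid M] (y : ℕ → M) (m : ℕ) :
    ∑ i ∈ Finset.range (2 * m + 1), (if i % 2 = 0 then y (i / 2) else 0) =
      ∑ i ∈ Finset.range (m + 1), y i := by
  induction m with
  | zero => simp
  | succ m ih =>
    rw [show 2 * (m + 1) + 1 = 2 * m + 1 + 1 + 1 by ring, Finset.sum_range_succ,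
      Finset.sum_range_succ, ih, Finset.sum_range_succ _ (m + 1)]
    simp [show (2 * m + 1) % 2 = 1 by omega, show (2 * m + 1 + 1) % 2 = 0 by omega,
      show (2 * m + 1 + 1) / 2 = m + 1 by omega]

open IsTripotentAddSqZero

/-- Degree `2 * (m + 1)`: the Newton basis is split into its even part `U` and its odd part `W`,
and multiplication by `X` carries the basis of `U` onto that of `W`. -/
theorem isTripotentAddSqZero_companionMat_of_even {f : (ZMod 3)[X]} (hf : f.Monic) {m : ℕ}
    (hm : f.natDegree = 2 * (m + 1)) (y : ℕ → ZMod 3)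
    (hsum : ∑ i ∈ Finset.range (m + 1), y i = polyTrace f) (hy : ∀ i < m, y i ≠ y m) :
    IsTripotentAddSqZero (companionMat f) := by
  obtain ⟨a, ha, -⟩ := exists_matSimilar_hessenbergMat hf (m := 2 * m + 1) (by omega)
    (fun i => if i % 2 = 1 then y (i / 2) else 0)
    (by rw [← hsum, ← sum_range_two_mul_of_odd y, show 2 * (m + 1) = 2 * m + 1 + 1 by ring])
  refine of_similar ha ?_
  rw [hm]
  let e₀ : Fin (m + 1) ⊕ Fin (m + 1) → Fin (2 * (m + 1)) :=
    Sum.elim (fun i => ⟨2 * i, by omega⟩) (fun i => ⟨2 * i + 1, by omega⟩)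
  have he₀ : Function.Bijective e₀ := by
    rw [Fintype.bijective_iff_injective_and_card]
    refine ⟨?_, by simp; omega⟩
    rintro (i | i) (j | j) h <;> simp [e₀, Fin.ext_iff] at h ⊢ <;> omega
  let e := Equiv.ofBijective e₀ he₀
  refine of_reindex e.symm ?_
  let Y : Matrix (Fin (m + 1)) (Fin (m + 1)) (ZMod 3) :=
    diagAddCol (Fin.last m) (fun i => y i) (fun i => if i = Fin.last m then 0 else a (2 * i + 1))
  have hY : Y ^ 3 = Y := diagAddCol_pow_three (by simp) fun i hi => by
    simpa using hy i (Fin.val_lt_last hi)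
  convert fromBlocks (Matrix.of fun i j => hessenbergMat _
    (fun i => if i % 2 = 1 then y (i / 2) else 0) a (e₀ (.inl i)) (e₀ (.inr j))) 1 1 hY
    (by simp) using 1
  ext (i | i) (j | j)
  · have : ¬ 2 * (j : ℕ) + 1 = 2 * (m + 1) := by omega
    have h2 : ¬ 2 * (i : ℕ) = 2 * j + 1 := by omega
    simp [e, e₀, hessenbergMat, this, h2]
  · simp [e]
  · have : ¬ 2 * (j : ℕ) + 1 = 2 * (m + 1) := by omega
    have h2 : ¬ 2 * (i : ℕ) + 1 = 2 * j := by omega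
    simp [e, e₀, hessenbergMat, this, h2, Matrix.one_apply, Fin.ext_iff]
  · have h1 : 2 * (j : ℕ) + 1 + 1 = 2 * (m + 1) ↔ j = Fin.last m := by
      rw [Fin.ext_iff, Fin.val_last]; omega
    have h2 : ¬ 2 * (i : ℕ) = 2 * j + 1 := by omega
    have h3 : (2 * (j : ℕ) + 1) / 2 = j := by omega
    by_cases hij : i = j
    · subst hij
      by_cases hi : i = Fin.last m <;>
        simp [e, e₀, hessenbergMat, Y, diagAddCol, hi, h3, Nat.add_mod,
          show (2 * m + 1) / 2 = m by omega]
    · have h4 : ¬ (i : ℕ) = j := fun h => hij (Fin.ext h)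
      by_cases hj : j = Fin.last m
      · subst hj
        rw [Fin.val_last] at h4
        simp [e, e₀, hessenbergMat, Y, diagAddCol, hij, h4, mul_add]
      · simp [e, e₀, hessenbergMat, Y, diagAddCol, hij, h1, h2, h4, hj]

/-- Degree `2 * m + 1` with `m > 0`: now `W` is the even part, one dimension larger than the odd
part `U`. As `1 - Y ^ 2` has no component along the first basis vector of `W`, the condition
`J * P * (1 - Y ^ 2) = 1 - Y ^ 2` still holds, although the image of `J` misses this vector. -/
theorem isTripotentAddSqZero_companionMat_of_odd {f : (ZMod 3)[X]} (hf : f.Monic) {m : ℕ}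
    (hm : f.natDegree = 2 * m + 1) (hm0 : 0 < m) (y : ℕ → ZMod 3)
    (hsum : ∑ i ∈ Finset.range (m + 1), y i = polyTrace f) (hy : ∀ i < m, y i ≠ y m)
    (hy0 : y 0 = -y m) :
    IsTripotentAddSqZero (companionMat f) := by
  obtain ⟨a, ha, -⟩ := exists_matSimilar_hessenbergMat hf (m := 2 * m) (by omega)
    (fun i => if i % 2 = 0 then y (i / 2) else 0)
    (by rw [← hsum, ← sum_range_two_mul_add_one_of_even y])
  refine of_similar ha ?_
  rw [hm]
  let e₀ : Fin m ⊕ Fin (m + 1) → Fin (2 * m + 1) :=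
    Sum.elim (fun i => ⟨2 * i + 1, by omega⟩) (fun i => ⟨2 * i, by omega⟩)
  have he₀ : Function.Bijective e₀ := by
    rw [Fintype.bijective_iff_injective_and_card]
    refine ⟨?_, by simp; omega⟩
    rintro (i | i) (j | j) h <;> simp [e₀, Fin.ext_iff] at h ⊢ <;> omega
  let e := Equiv.ofBijective e₀ he₀
  refine of_reindex e.symm ?_
  let Y : Matrix (Fin (m + 1)) (Fin (m + 1)) (ZMod 3) :=
    diagAddCol (Fin.last m) (fun i => y i) (fun i => if i = Fin.last m then 0 else a (2 * i))
  have hY : Y ^ 3 = Y := diagAddCol_pow_three (by simp) fun i hi => by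
    simpa using hy i (Fin.val_lt_last hi)
  let J : Matrix (Fin (m + 1)) (Fin m) (ZMod 3) := Matrix.of fun i j => if i = j.succ then 1 else 0
  have hJJ : J * J.transpose = Matrix.diagonal fun i => if i = 0 then 0 else 1 := by
    ext i j
    rw [Matrix.mul_apply]
    refine Fin.cases ?_ (fun i => ?_) i
    · refine Fin.cases ?_ (fun j => ?_) j
      · simp [J, (Fin.succ_ne_zero _).symm]
      · simp [J, (Fin.succ_ne_zero _).symm]
    · refine Fin.cases ?_ (fun j => ?_) j
      · simp [J, (Fin.succ_ne_zero _).symm]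
      · simp [J, Matrix.diagonal_apply]
  have hrow : ∀ j, (1 - Y ^ 2 : Matrix _ _ (ZMod 3)) 0 j = 0 := by
    intro j
    have h0 : (0 : Fin (m + 1)) ≠ Fin.last m := by
      rw [Ne, Fin.ext_iff, Fin.val_zero, Fin.val_last]; omega
    have h1 : y 0 * y 0 = 1 := by
      have h2 : y 0 ≠ y m := hy 0 hm0
      have h3 : ∀ b c : ZMod 3, b = -c → b ≠ c → b * b = 1 := by decide
      exact h3 _ _ hy0 h2
    -- Off its last entry the row is `1 - y 0 ^ 2 = 0` or `0`; its last entry has the factor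
    -- `y 0 + y m = 0`.
    rw [pow_two, diagAddCol_mul]
    by_cases hj : j = Fin.last m
    · subst hj
      simp [diagAddCol, h0, hy0]
      ring
    · by_cases hj0 : (0 : Fin (m + 1)) = j
      · subst hj0
        simp [diagAddCol, h1, h0]
      · simp [diagAddCol, hj, hj0]
  convert fromBlocks (Matrix.of fun i j => hessenbergMat _
    (fun i => if i % 2 = 0 then y (i / 2) else 0) a (e₀ (.inl i)) (e₀ (.inr j)))
    J.transpose J hY ?_ using 1
  · ext (i | i) (j | j)
    · have : ¬ 2 * (j : ℕ) + 1 = 2 * m := by omega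
      have h2 : ¬ 2 * (i : ℕ) = 2 * j + 1 := by omega
      simp [e, e₀, hessenbergMat, this, h2]
    · simp [e]
    · have h1 : ¬ 2 * (j : ℕ) + 1 = 2 * m := by omega
      have h2 : ¬ 2 * (i : ℕ) = 2 * j + 1 := by omega
      have h3 : 2 * (i : ℕ) = 2 * j + 1 + 1 ↔ i = j.succ := by
        rw [Fin.ext_iff, Fin.val_succ]; omega
      simp [e, e₀, hessenbergMat, h1, h2, h3, J]
    · have h1 : (j : ℕ) = m ↔ j = Fin.last m := by
        rw [Fin.ext_iff, Fin.val_last]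
      have h2 : ¬ 2 * (i : ℕ) = 2 * j + 1 := by omega
      by_cases hij : i = j
      · subst hij
        by_cases hi : i = Fin.last m <;>
          simp [e, e₀, hessenbergMat, Y, diagAddCol, hi]
      · have h4 : ¬ (i : ℕ) = j := fun h => hij (Fin.ext h)
        by_cases hj : j = Fin.last m
        · subst hj
          rw [Fin.val_last] at h4
          simp [e, e₀, hessenbergMat, Y, diagAddCol, hij, h4]
        · simp [e, e₀, hessenbergMat, Y, diagAddCol, hij, h1, h2, h4, hj]
  · rw [hJJ]
    ext i j
    rw [Matrix.diagonal_mul]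
    by_cases hi : i = 0
    · subst hi
      simp [hrow]
    · simp [hi]

/-- The root splits off the basis vector `1` up to one subdiagonal entry, which goes into the
square-zero part; the rest is the quadratic case. -/
theorem isTripotentAddSqZero_companionMat_of_natDegree_three_of_isRoot {f : (ZMod 3)[X]}
    (hf : f.Monic) (hm : f.natDegree = 3) {r : ZMod 3} (hr : f.IsRoot r) :
    IsTripotentAddSqZero (companionMat f) := by
  obtain ⟨a, ha, haf⟩ := exists_matSimilar_hessenbergMat hf (m := 2) hm
    (fun i => if i = 0 then r else if i = 1 then 0 else polyTrace f - r)
    (by simp [Finset.sum_range_succ])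
  -- The diagonal starts with the root `r`, so all Newton polynomials but the first vanish at `r`.
  have ha0 : a 0 = 0 := by
    have := congrArg (eval r) haf
    rw [IsRoot] at hr
    simpa [newtonPoly, Finset.prod_range_succ, Finset.sum_range_succ, hr] using this.symm
  refine of_similar ha ?_
  rw [hm]
  generalize polyTrace f - r = s
  have h3 : ∀ r s : ZMod 3, (!![r, 0, 0; 0, 0, 1 - s * s; 0, 1, s] :
      Matrix (Fin 3) (Fin 3) (ZMod 3)) ^ 3 = !![r, 0, 0; 0, 0, 1 - s * s; 0, 1, s] := by
    decide
  refine ⟨!![r, 0, 0; 0, 0, 1 - s * s; 0, 1, s], !![0, 0, 0; 1, 0, a 1 - (1 - s * s); 0, 0, 0],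
    h3 r s, ?_, ?_⟩
  · ext i j
    fin_cases i <;> fin_cases j <;> simp [pow_two, Matrix.mul_apply, Fin.sum_univ_three]
  · ext i j
    fin_cases i <;> fin_cases j <;> simp [hessenbergMat, ha0]

/-- Each degree and trace admits a sequence `y` as required by the two parity lemmas, except
degree `3` with non-zero trace. -/
theorem isTripotentAddSqZero_companionMat {f : (ZMod 3)[X]} (hf : f.Monic)
    (hd : 0 < f.natDegree)
    (h : ¬ (Irreducible f ∧ f.natDegree = 3 ∧ polyTrace f ≠ 0)) :
    IsTripotentAddSqZero (companionMat f) := by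
  rcases Nat.even_or_odd' f.natDegree with ⟨m, hm | hm⟩
  · obtain ⟨m, rfl⟩ : ∃ k, m = k + 1 := ⟨m - 1, by omega⟩
    by_cases ht : polyTrace f = 0
    · rcases Nat.eq_zero_or_pos m with rfl | hm0
      · exact isTripotentAddSqZero_companionMat_of_even hf hm (fun _ => 0) (by simp [ht]) (by simp)
      · refine isTripotentAddSqZero_companionMat_of_even hf hm
          (fun i => if i = 0 then -1 else if i = m then 1 else 0) ?_ ?_
        · obtain ⟨m, rfl⟩ : ∃ k, m = k + 1 := ⟨m - 1, by omega⟩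
          rw [Finset.sum_range_succ, Finset.sum_range_succ', Finset.sum_eq_zero, ht]
          · simp
          · intro i hi
            have := (Finset.mem_range.mp hi).ne
            simp [this]
        · intro i hi
          have h1 : (-1 : ZMod 3) ≠ 1 := by decide
          by_cases hi0 : i = 0
          · simp [hi0, hm0.ne', h1]
          · simp [hi0, hi.ne, hm0.ne']
    · refine isTripotentAddSqZero_companionMat_of_even hf hm
        (fun i => if i = m then polyTrace f else 0) ?_ ?_
      · simp
      · intro i hi
        simpa [hi.ne] using Ne.symm ht
  · rcases Nat.eq_zero_or_pos m with rfl | hm0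
    · have : Subsingleton (Fin f.natDegree) := by rw [hm, mul_zero, zero_add]; infer_instance
      exact of_subsingleton _
    -- For `m ≥ 2` the sequence is `-c, polyTrace f, 0, …, 0, c`; no term but the last may equal `c`.
    obtain ⟨c, hc0, hct⟩ : ∃ c : ZMod 3, c ≠ 0 ∧ polyTrace f ≠ c := by
      generalize polyTrace f = t
      revert t
      decide
    have hcc : ∀ c : ZMod 3, c ≠ 0 → -c ≠ c := by decide
    obtain rfl | hm1 : m = 1 ∨ 2 ≤ m := by omega
    · by_cases ht : polyTrace f = 0
      · refine isTripotentAddSqZero_companionMat_of_odd hf hm hm0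
          (fun i => if i = 0 then -c else c) ?_ ?_ ?_
        · simp [Finset.sum_range_succ, ht]
        · intro i hi
          simpa [show i = 0 by omega] using hcc c hc0
        · simp
      · have hirr : ¬ Irreducible f := fun hi => h ⟨hi, hm, ht⟩
        rw [hf.irreducible_iff_roots_eq_zero_of_degree_le_three (by omega) (by omega)] at hirr
        obtain ⟨r, hr⟩ := Multiset.exists_mem_of_ne_zero hirr
        exact isTripotentAddSqZero_companionMat_of_natDegree_three_of_isRoot hf hm
          (isRoot_of_mem_roots hr)
    · refine isTripotentAddSqZero_companionMat_of_odd hf hm hm0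
        (fun i => if i = 0 then -c else if i = m then c else if i = 1 then polyTrace f else 0)
        ?_ ?_ ?_
      · obtain ⟨m, rfl⟩ : ∃ k, m = k + 2 := ⟨m - 2, by omega⟩
        rw [Finset.sum_range_succ, Finset.sum_range_succ', Finset.sum_range_succ',
          Finset.sum_eq_zero]
        · simp
        · intro i hi
          have := (Finset.mem_range.mp hi).ne
          simp [this]
      · intro i hi
        by_cases hi0 : i = 0
        · simpa [hi0, hm0.ne'] using hcc c hc0
        · by_cases hi1 : i = 1
          · have : ¬ 1 = m := by omega
            simpa [hi1, hm0.ne', this] using hct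
          · simpa [hi0, hi1, hi.ne, hm0.ne'] using hc0.symm
      · simp [hm0.ne']

/-! ### Arbitrary matrices over `ZMod 3` -/

theorem corollary3p4 (n : ℕ) (A : Matrix (Fin n) (Fin n) (ZMod 3))
    (hA : ∀ p : (ZMod 3)[X], IsFirstInvariantFactor A p →
      ¬ (Irreducible p ∧ p.natDegree = 3 ∧ polyTrace p ≠ 0)) :
    ∃ D M : Matrix (Fin n) (Fin n) (ZMod 3),
      MatDiagonalizable D ∧ M ^ 2 = 0 ∧ A = D + M := by
  obtain ⟨k, f, hf⟩ := exists_isInvariantFactors A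
  obtain ⟨hfm, hfd, hfdvd, e, hsim⟩ := id hf
  have hgood : ∀ i, ¬ (Irreducible (f i) ∧ (f i).natDegree = 3 ∧ polyTrace (f i) ≠ 0) := by
    intro i hi
    obtain ⟨k, rfl⟩ : ∃ l, k = l + 1 := ⟨k - 1, by have := i.2; omega⟩
    -- `f 0` divides the irreducible `f i`, and both are monic and non-constant.
    have h0 : f 0 = f i := by
      refine eq_of_monic_of_associated (hfm 0) (hfm i) ?_
      refine ((hi.1.dvd_iff.mp (hfdvd 0 i (Fin.zero_le i))).resolve_left fun hu => ?_).symm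
      exact (hfd 0).ne' (natDegree_eq_zero_of_isUnit hu)
    exact hA (f 0) ⟨k, f, hf, rfl⟩ (h0 ▸ hi)
  obtain ⟨D, M, hD, hM, h⟩ := of_similar hsim ((IsTripotentAddSqZero.blockDiagonal' fun i =>
    isTripotentAddSqZero_companionMat (hfm i) (hfd i) (hgood i)).reindex e)
  exact ⟨D, M, matDiagonalizable_of_pow_three_eq hD, hM, h⟩
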